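/- A group $G$ is called fully realizable if there is a ring $R$ with identity such that $R^\times\cong G$ and every group endomorphism of $G=R^\times$ is the restriction $\phi^\times$ of some ring endomorphism $\phi$ of $R$. Write $\mathbf{C}_n$ for the cyclic group of order $n$ and let $\mathbf{C}_6=\langle x\rangle$. Let $Q$ be the Klein four group $\langle a\rangle\times\langle b\rangle$ with the $\mathbf{C}_6$-action in which $x$ acts by $a\mapsto ab$, $b\mapsto b$ (so $\langle x^2\rangle$ acts trivially and $\langle x^3\rangle$ acts faithfully). Let $Y\otimes Q$ be the elementary abelian group $\langle\alpha,\beta,\gamma,\delta\rangle\cong \mathbf{C}_2^4$ with the $\mathbf{C}_6$-action in which $x$ acts by $\alpha\mapsto\alpha\beta\gamma\delta$, $\beta\mapsto\beta\delta$, $\gamma\mapsto\alpha\beta$, $\delta\mapsto\beta$. **Theorem.** Let $A$ be a finite elementary abelian $2$-group equipped with a $\mathbf{C}_6$-action. 1. The group $A\rtimes \mathbf{C}_6$ is fully realizable if and only if $Q$ is not a direct summand of $A$, i.e. there is no decomposition $A=B\times C$ into $\mathbf{C}_6$-stable subgroups with $B$ isomorphic to $Q$ as a group with $\mathbf{C}_6$-action.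 2. Suppose that $Q$ is not a direct summand of $A$ and that $x^3$ acts nontrivially on $A$. Then $H=A\rtimes\langle x^3\rangle$ is a nonabelian $2$-group, and there is an action of $\mathbf{C}_3$ on $H$ such that $H\rtimes \mathbf{C}_3\cong A\rtimes \mathbf{C}_6$ and $H\rtimes\mathbf{C}_3$ is fully realizable. 3. In particular, the group $(Y\otimes Q)\rtimes \mathbf{C}_6$ of order $96$ (called GAP id $(96,70)$ in the literature) is isomorphic to a semidirect product $H\rtimes \mathbf{C}_3$ with $H=(Y\otimes Q)\rtimes\langle x^3\rangle$ nonabelian of order $32$, and it is fully realizable. -/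

import Mathlib

universe u v

/-- A group `G` is *fully realizable* if there is a unital ring `R` whose group of units is
(isomorphic to) `G` and such that every endomorphism of `G` is induced by a ring endomorphism
of `R`. -/
def FullyRealizable (G : Type u) [Group G] : Prop :=
  ∃ (R : Type v) (_ : Ring R) (e : G ≃* Rˣ),
    ∀ f : G →* G, ∃ F : R →+* R, ∀ g : G, Units.map (F : R →* R) (e g) = e (f g)

/-- The cyclic group of order six, written multiplicatively. -/
abbrev C6 : Type := Multiplicative (ZMod 6)

/-- The distinguished generator `x` of `C6`. -/
def C6.x : C6 := Multiplicative.ofAdd (1 : ZMod 6)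

/-- The action of `C6 = ⟨x⟩` on a group `M` in which `x` acts as a given automorphism `T`
with `T ^ 6 = 1`. -/
def C6.actionOf {M : Type*} [Group M] (T : MulAut M) (hT : T ^ 6 = 1) : C6 →* MulAut M where
  toFun k := T ^ (Multiplicative.toAdd k).val
  map_one' := by simp
  map_mul' a b := by
    rw [toAdd_mul, ZMod.val_add, ← pow_add, ← pow_eq_pow_mod _ hT]

theorem C6.actionOf_x {M : Type*} [Group M] (T : MulAut M) (hT : T ^ 6 = 1) :
    C6.actionOf T hT C6.x = T :=
  pow_one T

/-- Let a group `Γ` act on the abelian groups `M` and `A`.  `M` is a *direct summand* of `A` if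
`A` is the internal direct product of two `Γ`-stable subgroups `B` and `C`, where `B` is
`Γ`-equivariantly isomorphic to `M`. -/
def IsDirectSummand {Γ M A : Type*} [Group Γ] [CommGroup M] [CommGroup A]
    (ψ : Γ →* MulAut M) (φ : Γ →* MulAut A) : Prop :=
  ∃ B C : Subgroup A, IsCompl B C ∧
    (∀ g : Γ, ∀ b ∈ B, φ g b ∈ B) ∧ (∀ g : Γ, ∀ c ∈ C, φ g c ∈ C) ∧
    ∃ e : M ≃* B, ∀ (g : Γ) (m : M), (e (ψ g m) : A) = φ g (e m)

/-- The underlying group of the module `Q`: the Klein four group `⟨a⟩ × ⟨b⟩`, where `(s, t)`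
stands for `a ^ s * b ^ t`. -/
abbrev QGroup : Type := Multiplicative (ZMod 2 × ZMod 2)

/-- The automorphism `a ↦ a * b`, `b ↦ b` of `Q`. -/
def QAut : MulAut QGroup :=
  AddEquiv.toMultiplicative
    { toFun := fun m => (m.1, m.1 + m.2)
      invFun := fun m => (m.1, m.1 + m.2)
      left_inv := by decide
      right_inv := by decide
      map_add' := by decide }

/-- The module `Q`: the generator `x` of `C6` acts by `a ↦ a * b`, `b ↦ b`.  So the subgroup
`⟨x ^ 2⟩` of order three acts trivially and `⟨x ^ 3⟩` acts faithfully. -/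
def QAction : C6 →* MulAut QGroup :=
  C6.actionOf QAut (MulEquiv.ext (by decide))

/-- The underlying group of `Y ⊗ Q`: the elementary abelian group
`⟨α⟩ × ⟨β⟩ × ⟨γ⟩ × ⟨δ⟩` of order sixteen, where `(p, q, r, s)` stands for
`α ^ p * β ^ q * γ ^ r * δ ^ s`. -/
abbrev YQGroup : Type := Multiplicative (ZMod 2 × ZMod 2 × ZMod 2 × ZMod 2)

/-- The automorphism `α ↦ α * β * γ * δ`, `β ↦ β * δ`, `γ ↦ α * β`, `δ ↦ β` of `Y ⊗ Q`. It is the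
tensor product of the automorphism `a ↦ a * b`, `b ↦ a` of `Y` (of order three) and the
automorphism `a ↦ a * b`, `b ↦ b` of `Q`, in the basis
`α = a ⊗ a`, `β = a ⊗ b`, `γ = b ⊗ a`, `δ = b ⊗ b`. -/
def YQAut : MulAut YQGroup :=
  AddEquiv.toMultiplicative
    { toFun := fun m =>
        (m.1 + m.2.2.1, m.1 + m.2.1 + m.2.2.1 + m.2.2.2, m.1, m.1 + m.2.1)
      invFun := fun m =>
        (m.2.2.1, m.2.2.1 + m.2.2.2, m.1 + m.2.2.1, m.1 + m.2.1 + m.2.2.1 + m.2.2.2)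
      left_inv := by decide
      right_inv := by decide
      map_add' := by decide }

/-- The module `Y ⊗ Q`. -/
def YQAction : C6 →* MulAut YQGroup :=
  C6.actionOf YQAut (MulEquiv.ext (by decide))

/-- For an action `φ` of `C6 = ⟨x⟩` on `A`, the semidirect product `A ⋊ C_2`, where
`C_2 = ⟨x ^ 3⟩` is the subgroup of order two of `C6`. -/
abbrev SemidirectC2 {A : Type*} [CommGroup A] (φ : C6 →* MulAut A) : Type _ :=
  A ⋊[φ.comp (Subgroup.zpowers (C6.x ^ 3)).subtype] Subgroup.zpowers (C6.x ^ 3)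

/-- The cyclic group of order three, written multiplicatively. -/
abbrev C3 : Type := Multiplicative (ZMod 3)

/-! The criterion comes from a pointwise condition: every element of `A` fixed by `x ^ 2` is fixed
by `x ^ 3`. An element violating it generates a copy of `Q`, which a norm map splits off
(`isDirectSummand_of_not_fixed`).

Under this condition the ring is the square zero extension by `A` of `C6Ring`, whose units are `C6`.
Since φ(x) need not satisfy X⁴ + X³ + X + 1 = 0, the action is split along k = k ^ 3 * k ^ 4: the
order three part acts on the left, the order two part on the right, and conjugation recovers φ. The
group spans the ring additively, so an endomorphism `f` extends once the images under `f` satisfy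
the relations (g - 1)(h - 1) = 0 that govern the span (`exists_ringHom_toTrivSqZeroExt`). The
pointwise condition is needed for only one of them.

Conversely, if `Q` is a summand, then `Q ⋊ C6` is a retract of the group. A realizing ring has
characteristic two, and the noncommuting involutions t = x ^ 3 and q = a generate a dihedral group
of order 8, so 1 + t + q is a unit. Swapping t and q, then killing q alone, forces contradictory
properties on the corresponding group element (`not_fullyRealizable_of_isDirectSummand`). -/

/-- A finite ring is small, so it can be moved to any universe `v`; the hypothesis is phrased in `R`
to avoid maps of unit groups. -/
theorem FullyRealizable.of_finite {G : Type u} [Group G] {R : Type*} [Ring R] [Finite R]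
    (e : G ≃* Rˣ)
    (h : ∀ f : G →* G, ∃ F : R →+* R, ∀ g : G, F (e g) = e (f g)) :
    FullyRealizable.{u, v} G := by
  refine ⟨Shrink.{v} R, inferInstance,
    e.trans (Units.mapEquiv (Shrink.ringEquiv.{v} R).symm.toMulEquiv), fun f => ?_⟩
  obtain ⟨F, hF⟩ := h f
  refine ⟨((Shrink.ringEquiv.{v} R).symm : R →+* Shrink.{v} R).comp
    (F.comp (Shrink.ringEquiv.{v} R : Shrink.{v} R →+* R)), fun g => ?_⟩
  ext
  simp [hF]

theorem FullyRealizable.of_mulEquiv {G H : Type u} [Group G] [Group H] (i : G ≃* H)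
    (h : FullyRealizable.{u, v} G) : FullyRealizable.{u, v} H := by
  obtain ⟨R, _, e, hR⟩ := h
  refine ⟨R, inferInstance, i.symm.trans e, fun f => ?_⟩
  obtain ⟨F, hF⟩ := hR ((i.symm : H →* G).comp (f.comp (i : G →* H)))
  exact ⟨F, fun g => by simpa using hF (i.symm g)⟩

/-- An additive map of a ring spanned by the image of a group that is multiplicative on that
image is a ring homomorphism. -/
theorem exists_ringHom_of_addMonoidHom {G R : Type*} [Group G] [Ring R] (E : G →* R)
    (hE : AddSubgroup.closure (Set.range E) = ⊤) (f : G →* G) (F : R →+ R)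
    (hF : ∀ g, F (E g) = E (f g)) : ∃ F' : R →+* R, ∀ g, F' (E g) = E (f g) := by
  have hm : ∀ x y, F (x * y) = F x * F y := by
    intro x y
    have hx : x ∈ AddSubgroup.closure (Set.range E) := hE ▸ AddSubgroup.mem_top x
    have hy : y ∈ AddSubgroup.closure (Set.range E) := hE ▸ AddSubgroup.mem_top y
    induction hx using AddSubgroup.closure_induction with
    | mem x hx =>
      obtain ⟨g, rfl⟩ := hx
      induction hy using AddSubgroup.closure_induction with
      | mem y hy =>
        obtain ⟨h, rfl⟩ := hy
        rw [← map_mul, hF, hF, hF, map_mul, map_mul]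
      | zero => simp
      | add y z _ _ hy hz => simp only [mul_add, map_add, hy, hz]
      | neg y _ hy => simp only [mul_neg, map_neg, hy]
    | zero => simp
    | add y z _ _ hy hz => simp only [add_mul, map_add, hy, hz]
    | neg y _ hy => simp only [neg_mul, map_neg, hy]
  exact ⟨{ F with
    map_one' := by simpa using hF 1
    map_mul' := hm }, hF⟩

/-! ### The coefficient ring with unit group of order six, and its modules -/

/-- The ring `𝔽₂[X] / (X ^ 4 + X ^ 3 + X + 1)`, in the basis `1, X, X ^ 2, X ^ 3`. Its group of
units is cyclic of order six, generated by `X`. -/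
@[ext]
structure C6Ring : Type where
  c0 : ZMod 2
  c1 : ZMod 2
  c2 : ZMod 2
  c3 : ZMod 2
deriving DecidableEq

namespace C6Ring

def equivProd : C6Ring ≃ ZMod 2 × ZMod 2 × ZMod 2 × ZMod 2 where
  toFun s := (s.c0, s.c1, s.c2, s.c3)
  invFun s := ⟨s.1, s.2.1, s.2.2.1, s.2.2.2⟩

instance : Fintype C6Ring := Fintype.ofEquiv _ equivProd.symm

instance : Zero C6Ring := ⟨⟨0, 0, 0, 0⟩⟩
instance : One C6Ring := ⟨⟨1, 0, 0, 0⟩⟩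
instance : Add C6Ring := ⟨fun s t => ⟨s.c0 + t.c0, s.c1 + t.c1, s.c2 + t.c2, s.c3 + t.c3⟩⟩
instance : Neg C6Ring := ⟨fun s => ⟨-s.c0, -s.c1, -s.c2, -s.c3⟩⟩
-- Products are reduced by X⁴ = -X³ - X - 1, X⁵ = X³ - X² + 1 and X⁶ = -2X³ - 1. With the signs
-- kept, the ring axioms are polynomial identities over ℤ that `ring` can prove.
instance : Mul C6Ring := ⟨fun s t =>
  ⟨s.c0 * t.c0 - (s.c1 * t.c3 + s.c2 * t.c2 + s.c3 * t.c1) + (s.c2 * t.c3 + s.c3 * t.c2)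
      - s.c3 * t.c3,
    s.c0 * t.c1 + s.c1 * t.c0 - (s.c1 * t.c3 + s.c2 * t.c2 + s.c3 * t.c1),
    s.c0 * t.c2 + s.c1 * t.c1 + s.c2 * t.c0 - (s.c2 * t.c3 + s.c3 * t.c2),
    s.c0 * t.c3 + s.c1 * t.c2 + s.c2 * t.c1 + s.c3 * t.c0
      - (s.c1 * t.c3 + s.c2 * t.c2 + s.c3 * t.c1) + (s.c2 * t.c3 + s.c3 * t.c2)
      - 2 * (s.c3 * t.c3)⟩⟩

theorem zero_def : (0 : C6Ring) = ⟨0, 0, 0, 0⟩ := rfl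
theorem one_def : (1 : C6Ring) = ⟨1, 0, 0, 0⟩ := rfl
theorem add_def (s t : C6Ring) :
    s + t = ⟨s.c0 + t.c0, s.c1 + t.c1, s.c2 + t.c2, s.c3 + t.c3⟩ := rfl
theorem neg_def (s : C6Ring) : -s = ⟨-s.c0, -s.c1, -s.c2, -s.c3⟩ := rfl
theorem mul_def (s t : C6Ring) : s * t =
  ⟨s.c0 * t.c0 - (s.c1 * t.c3 + s.c2 * t.c2 + s.c3 * t.c1) + (s.c2 * t.c3 + s.c3 * t.c2)
      - s.c3 * t.c3,
    s.c0 * t.c1 + s.c1 * t.c0 - (s.c1 * t.c3 + s.c2 * t.c2 + s.c3 * t.c1),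
    s.c0 * t.c2 + s.c1 * t.c1 + s.c2 * t.c0 - (s.c2 * t.c3 + s.c3 * t.c2),
    s.c0 * t.c3 + s.c1 * t.c2 + s.c2 * t.c1 + s.c3 * t.c0
      - (s.c1 * t.c3 + s.c2 * t.c2 + s.c3 * t.c1) + (s.c2 * t.c3 + s.c3 * t.c2)
      - 2 * (s.c3 * t.c3)⟩ := rfl

instance : CommRing C6Ring where
  add_assoc a b c := by simp only [add_def, add_assoc]
  zero_add a := by simp only [add_def, zero_def, zero_add]
  add_zero a := by simp only [add_def, zero_def, add_zero]
  add_comm a b := by simp only [add_def, add_comm]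
  neg_add_cancel a := by simp only [add_def, zero_def, neg_def, neg_add_cancel]
  nsmul := nsmulRec
  zsmul := zsmulRec
  zero_mul a := by simp [mul_def, zero_def]
  mul_zero a := by simp [mul_def, zero_def]
  one_mul a := by simp [mul_def, one_def]
  mul_one a := by simp [mul_def, one_def]
  mul_assoc a b c := by
    simp only [mul_def]
    ext <;> ring
  mul_comm a b := by
    simp only [mul_def]
    ext <;> ring
  left_distrib a b c := by
    simp only [mul_def, add_def]
    ext <;> ring
  right_distrib a b c := by
    simp only [mul_def, add_def]
    ext <;> ring

def X : C6Ring := ⟨0, 1, 0, 0⟩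

/-- The embedding of the cyclic group of order six as the group of units. -/
def ofC6 : C6 →* C6Ring where
  toFun k := X ^ (Multiplicative.toAdd k).val
  map_one' := by decide
  map_mul' := by decide

theorem ofC6_injective : Function.Injective ofC6 := by unfold Function.Injective; decide

theorem exists_ofC6_eq : ∀ s t : C6Ring, s * t = 1 → ∃ k, ofC6 k = s := by decide +kernel

theorem two_eq_zero : (2 : C6Ring) = 0 := by decide

/-- A linear endomorphism `T` of an `𝔽₂`-vector space with `T ^ 4 + T ^ 3 + T + 1 = 0` makes it a
module on which `X` acts as `T`. -/
abbrev moduleOf {M : Type*} [AddCommGroup M] [Module (ZMod 2) M] (T : M →ₗ[ZMod 2] M)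
    (hT : ∀ m, T (T (T (T m))) = - T (T (T m)) - T m - m) : Module C6Ring M where
  smul s m := s.c0 • m + s.c1 • T m + s.c2 • T (T m) + s.c3 • T (T (T m))
  one_smul m := show (1 : ZMod 2) • m + (0 : ZMod 2) • T m + (0 : ZMod 2) • T (T m)
    + (0 : ZMod 2) • T (T (T m)) = m by module
  zero_smul m := show (0 : ZMod 2) • m + (0 : ZMod 2) • T m + (0 : ZMod 2) • T (T m)
    + (0 : ZMod 2) • T (T (T m)) = 0 by module
  smul_zero s := show s.c0 • (0 : M) + s.c1 • T 0 + s.c2 • T (T 0) + s.c3 • T (T (T 0)) = 0 by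
    simp
  smul_add s m n := show s.c0 • (m + n) + s.c1 • T (m + n) + s.c2 • T (T (m + n))
      + s.c3 • T (T (T (m + n))) =
      (s.c0 • m + s.c1 • T m + s.c2 • T (T m) + s.c3 • T (T (T m))) +
      (s.c0 • n + s.c1 • T n + s.c2 • T (T n) + s.c3 • T (T (T n))) by
    simp only [map_add]
    module
  add_smul s t m := show (s.c0 + t.c0) • m + (s.c1 + t.c1) • T m + (s.c2 + t.c2) • T (T m)
      + (s.c3 + t.c3) • T (T (T m)) =
      (s.c0 • m + s.c1 • T m + s.c2 • T (T m) + s.c3 • T (T (T m))) +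
      (t.c0 • m + t.c1 • T m + t.c2 • T (T m) + t.c3 • T (T (T m))) by
    module
  mul_smul s t m := by
    change (s * t).c0 • m + (s * t).c1 • T m + (s * t).c2 • T (T m) + (s * t).c3 • T (T (T m)) =
      s.c0 • (t.c0 • m + t.c1 • T m + t.c2 • T (T m) + t.c3 • T (T (T m))) +
      s.c1 • T (t.c0 • m + t.c1 • T m + t.c2 • T (T m) + t.c3 • T (T (T m))) +
      s.c2 • T (T (t.c0 • m + t.c1 • T m + t.c2 • T (T m) + t.c3 • T (T (T m)))) +
      s.c3 • T (T (T (t.c0 • m + t.c1 • T m + t.c2 • T (T m) + t.c3 • T (T (T m)))))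
    simp only [mul_def, map_add, map_smul, map_sub, map_neg, hT]
    module

theorem moduleOf_X_smul {M : Type*} [AddCommGroup M] [Module (ZMod 2) M] (T : M →ₗ[ZMod 2] M)
    (hT : ∀ m, T (T (T (T m))) = - T (T (T m)) - T m - m) (m : M) :
    let _ := moduleOf T hT
    X • m = T m := by
  change (0 : ZMod 2) • m + (1 : ZMod 2) • T m + (0 : ZMod 2) • T (T m)
    + (0 : ZMod 2) • T (T (T m)) = T m
  module

/-- An element `y` with `y ^ 4 = y ^ 3 + y + 1` of a ring of characteristic two defines an additive
map `X ^ i ↦ y ^ i`. -/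
theorem exists_addMonoidHom {R : Type*} [Ring R] (h2 : (2 : R) = 0) (y : R)
    (hy : y ^ 4 = y ^ 3 + y + 1) :
    ∃ σ : C6Ring →+ R, ∀ k : C6, σ (ofC6 k) = y ^ (Multiplicative.toAdd k).val := by
  have h2' : ∀ z : R, 2 • z = 0 := fun z => by rw [two_nsmul, ← two_mul, h2, zero_mul]
  let _ : Module (ZMod 2) R := AddCommGroup.zmodModule h2'
  let σ : C6Ring →+ R :=
    { toFun := fun s => s.c0 • 1 + s.c1 • y + s.c2 • y ^ 2 + s.c3 • y ^ 3
      map_zero' := by simp [zero_def]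
      map_add' := fun s t => by
        simp only [add_def]
        module }
  have hσ : ∀ s, σ s = s.c0 • 1 + s.c1 • y + s.c2 • y ^ 2 + s.c3 • y ^ 3 := fun _ => rfl
  have h5 : y ^ 5 = y ^ 3 + y ^ 2 + 1 := by
    have : y ^ 5 = (y ^ 3 + y ^ 2 + 1) + 2 * y := by
      rw [pow_succ, hy, add_mul, add_mul, ← pow_succ, hy]
      noncomm_ring
    rw [this, h2, zero_mul, add_zero]
  refine ⟨σ, fun k => ?_⟩
  obtain ⟨k, rfl⟩ := Multiplicative.ofAdd.surjective k
  rw [hσ]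
  fin_cases k
  · change (1 : ZMod 2) • 1 + (0 : ZMod 2) • y + (0 : ZMod 2) • y ^ 2 + (0 : ZMod 2) • y ^ 3 = y ^ 0
    simp
  · change (0 : ZMod 2) • 1 + (1 : ZMod 2) • y + (0 : ZMod 2) • y ^ 2 + (0 : ZMod 2) • y ^ 3 = y ^ 1
    simp
  · change (0 : ZMod 2) • 1 + (0 : ZMod 2) • y + (1 : ZMod 2) • y ^ 2 + (0 : ZMod 2) • y ^ 3 = y ^ 2
    simp
  · change (0 : ZMod 2) • 1 + (0 : ZMod 2) • y + (0 : ZMod 2) • y ^ 2 + (1 : ZMod 2) • y ^ 3 = y ^ 3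
    simp
  · change (1 : ZMod 2) • 1 + (1 : ZMod 2) • y + (0 : ZMod 2) • y ^ 2 + (1 : ZMod 2) • y ^ 3 = y ^ 4
    rw [hy]
    module
  · change (1 : ZMod 2) • 1 + (0 : ZMod 2) • y + (1 : ZMod 2) • y ^ 2 + (1 : ZMod 2) • y ^ 3 = y ^ 5
    rw [h5]
    module

theorem closure_range_ofC6 : AddSubgroup.closure (Set.range ofC6) = ⊤ := by
  rw [eq_top_iff]
  intro s hs
  clear hs
  have h : ∃ a b c d : Bool, s = (if a then ofC6 1 else 0) + (if b then ofC6 C6.x else 0) +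
      (if c then ofC6 (C6.x ^ 2) else 0) + (if d then ofC6 (C6.x ^ 3) else 0) := by
    revert s
    decide +kernel
  obtain ⟨a, b, c, d, rfl⟩ := h
  have key : ∀ (a : Bool) (k : C6),
      (if a then ofC6 k else 0) ∈ AddSubgroup.closure (Set.range ofC6) := by
    intro a k
    split_ifs
    · exact AddSubgroup.subset_closure ⟨k, rfl⟩
    · exact zero_mem _
  exact add_mem (add_mem (add_mem (key _ _) (key _ _)) (key _ _)) (key _ _)

end C6Ring

/-! ### Realizing `A ⋊ C6` by a square zero extension -/

namespace C6

open C6Ring MulOpposite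

theorem x_pow_three_cases : ∀ k : C6, k ^ 2 = 1 → k = 1 ∨ k = x ^ 3 := by decide

theorem exists_pow_eq : ∀ k : C6, ∃ n : Fin 6, k = x ^ (n : ℕ) := by decide

theorem eq_pow_three_mul_pow_four : ∀ k : C6, k = k ^ 3 * k ^ 4 := by decide

theorem pow_six : ∀ k : C6, k ^ 6 = 1 := by decide

/-- Over 𝔽₂ the defining polynomial is (X + 1)(X³ + 1) = (X + 1)²(X² + X + 1). Here k - 1 is a
multiple of X³ + 1, and l - 1 is a multiple of X² + 1 or of X³ + 1, so the product vanishes. -/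
theorem ofC6_sub_mul_sub : ∀ k l : C6, k ^ 2 = 1 → l ^ 3 = 1 ∨ l ^ 2 = 1 →
    (ofC6 k - 1) * (ofC6 l - 1) = 0 := by decide

section

variable {A : Type u} [CommGroup A] {φ : C6 →* MulAut A}

theorem aut_mul_apply (k l : C6) (a : A) : φ k (φ l a) = φ (k * l) a := by
  rw [map_mul, MulAut.mul_apply]

/-- If `g` is an involution commuting with the involution `h`, then `h` fixes the first component
of `g`. -/
theorem aut_right_left_of_commute (hA : ∀ a : A, a ^ 2 = 1) {g h : A ⋊[φ] C6}
    (hg : g ^ 2 = 1) (hh : h ^ 2 = 1) (hgh : g * h = h * g) : φ h.right g.left = g.left := by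
  have hinv : ∀ a : A, a⁻¹ = a := fun a => inv_eq_of_mul_eq_one_left (by rw [← sq, hA])
  have hgr : g.right ^ 2 = 1 := by
    rw [← SemidirectProduct.rightHom_eq_right, ← map_pow, hg, map_one]
  have hhr : h.right ^ 2 = 1 := by
    rw [← SemidirectProduct.rightHom_eq_right, ← map_pow, hh, map_one]
  rcases x_pow_three_cases _ hhr with h1 | h1
  · rw [h1, map_one, MulAut.one_apply]
  rcases x_pow_three_cases _ hgr with h2 | h2
  · have := congrArg SemidirectProduct.left hgh
    rw [SemidirectProduct.mul_left, SemidirectProduct.mul_left, h2, map_one, MulAut.one_apply,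
      mul_comm h.left] at this
    exact (mul_right_cancel this).symm
  -- Both right components are x ^ 3, and g ^ 2 = 1 already says that x ^ 3 inverts, hence fixes,
  -- `g.left`.
  · have := congrArg SemidirectProduct.left hg
    rw [sq, SemidirectProduct.mul_left, h2, SemidirectProduct.one_left] at this
    rw [h1, eq_inv_of_mul_eq_one_right this, hinv]

variable [Module C6Ring (Additive A)] [Module C6Ringᵐᵒᵖ (Additive A)]
  [SMulCommClass C6Ring C6Ringᵐᵒᵖ (Additive A)]

set_option linter.unusedSectionVars false

/-- The embedding of `A ⋊ C6` into the units of the square zero extension by `A` of `C6Ring`, for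
the bimodule structure on `A` in which `k` acts on the left as `k ^ 4` and on the right as
`k ^ 3`. -/
def toTrivSqZeroExt
    (hl : ∀ (k : C6) (a : Additive A), ofC6 k • a = Additive.ofMul (φ (k ^ 4) a.toMul))
    (hr : ∀ (k : C6) (a : Additive A), op (ofC6 k) • a = Additive.ofMul (φ (k ^ 3) a.toMul)) :
    A ⋊[φ] C6 →* TrivSqZeroExt C6Ring (Additive A) where
  -- This is the product (1 + a) * k; its second component is `a` acted on by `k` from the right,
  -- hence the power k ^ 3.
  toFun g := TrivSqZeroExt.inl (ofC6 g.right)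
    + TrivSqZeroExt.inr (Additive.ofMul (φ (g.right ^ 3) g.left))
  map_one' := by
    simp
  map_mul' g h := by
    apply TrivSqZeroExt.ext
    · simp
    · simp only [TrivSqZeroExt.snd_mul, TrivSqZeroExt.fst_add, TrivSqZeroExt.snd_add,
        TrivSqZeroExt.fst_inl, TrivSqZeroExt.snd_inl, TrivSqZeroExt.fst_inr, TrivSqZeroExt.snd_inr,
        add_zero, zero_add]
      change Additive.ofMul (φ ((g.right * h.right) ^ 3) (g.left * φ g.right h.left)) =
        ofC6 g.right • Additive.ofMul (φ (h.right ^ 3) h.left)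
          + op (ofC6 h.right) • Additive.ofMul (φ (g.right ^ 3) g.left)
      rw [hl, hr, toMul_ofMul, toMul_ofMul, ← ofMul_mul, map_mul, aut_mul_apply, aut_mul_apply,
        aut_mul_apply, mul_comm (φ (g.right ^ 4 * h.right ^ 3) h.left)]
      congr 4
      · rw [mul_pow, mul_comm]
      · rw [mul_pow, mul_right_comm, ← pow_succ]

variable
    (hl : ∀ (k : C6) (a : Additive A), ofC6 k • a = Additive.ofMul (φ (k ^ 4) a.toMul))
    (hr : ∀ (k : C6) (a : Additive A), op (ofC6 k) • a = Additive.ofMul (φ (k ^ 3) a.toMul))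

theorem toTrivSqZeroExt_fst (g : A ⋊[φ] C6) : (toTrivSqZeroExt hl hr g).fst = ofC6 g.right := by
  simp [toTrivSqZeroExt]

theorem toTrivSqZeroExt_snd (g : A ⋊[φ] C6) :
    (toTrivSqZeroExt hl hr g).snd = Additive.ofMul (φ (g.right ^ 3) g.left) := by
  simp [toTrivSqZeroExt]

theorem toTrivSqZeroExt_injective : Function.Injective (toTrivSqZeroExt hl hr) := by
  intro g h hgh
  have h1 : g.right = h.right := ofC6_injective (by
    rw [← toTrivSqZeroExt_fst hl hr, hgh, toTrivSqZeroExt_fst])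
  have h2 : φ (g.right ^ 3) g.left = φ (h.right ^ 3) h.left := Additive.ofMul.injective (by
    rw [← toTrivSqZeroExt_snd hl hr, hgh, toTrivSqZeroExt_snd])
  rw [h1] at h2
  exact SemidirectProduct.ext ((φ _).injective h2) h1

theorem exists_toTrivSqZeroExt_eq {z : TrivSqZeroExt C6Ring (Additive A)} (hz : IsUnit z) :
    ∃ g, toTrivSqZeroExt hl hr g = z := by
  obtain ⟨w, hw⟩ := hz.exists_right_inv
  obtain ⟨k, hk⟩ := exists_ofC6_eq _ _ (congrArg TrivSqZeroExt.fst hw)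
  refine ⟨⟨φ ((k ^ 3)⁻¹) z.snd.toMul, k⟩, 
    TrivSqZeroExt.ext ((toTrivSqZeroExt_fst hl hr _).trans hk) ?_⟩
  rw [toTrivSqZeroExt_snd]
  simp only [aut_mul_apply, mul_inv_cancel, map_one, MulAut.one_apply]
  rfl

theorem closure_range_toTrivSqZeroExt :
    AddSubgroup.closure (Set.range (toTrivSqZeroExt hl hr)) = ⊤ := by
  have hl' : ∀ s : C6Ring, (TrivSqZeroExt.inl s : TrivSqZeroExt C6Ring (Additive A)) ∈
      AddSubgroup.closure (Set.range (toTrivSqZeroExt hl hr)) := by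
    intro s
    have hs : s ∈ AddSubgroup.closure (Set.range ofC6) := closure_range_ofC6 ▸ AddSubgroup.mem_top s
    induction hs using AddSubgroup.closure_induction with
    | mem s hs =>
      obtain ⟨k, rfl⟩ := hs
      refine AddSubgroup.subset_closure ⟨SemidirectProduct.inr k,
        TrivSqZeroExt.ext (toTrivSqZeroExt_fst hl hr _) ?_⟩
      rw [toTrivSqZeroExt_snd, SemidirectProduct.left_inr, map_one]
      rfl
    | zero => rw [TrivSqZeroExt.inl_zero]; exact zero_mem _
    | add s t _ _ hs ht => rw [TrivSqZeroExt.inl_add]; exact add_mem hs ht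
    | neg s _ hs => rw [TrivSqZeroExt.inl_neg]; exact neg_mem hs
  rw [eq_top_iff]
  intro z _
  have h : z = toTrivSqZeroExt hl hr (SemidirectProduct.inl z.snd.toMul)
      + TrivSqZeroExt.inl (z.fst - 1) := by
    apply TrivSqZeroExt.ext
    · rw [TrivSqZeroExt.fst_add, toTrivSqZeroExt_fst, TrivSqZeroExt.fst_inl,
        SemidirectProduct.right_inl, map_one, add_sub_cancel]
    · rw [TrivSqZeroExt.snd_add, toTrivSqZeroExt_snd, TrivSqZeroExt.snd_inl,
        SemidirectProduct.right_inl, one_pow, map_one, add_zero]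
      rfl
  rw [h]
  exact add_mem (AddSubgroup.subset_closure ⟨_, rfl⟩) (hl' _)

/-- The second component is a sum of a left multiple by g.right - 1 and a right multiple by h.right
- 1. Both vanish: the left action goes through g.right ^ 4 = 1 and the right one through h.right ^ 3
= 1. -/
theorem toTrivSqZeroExt_sub_mul_sub_of_pow_three {g h : A ⋊[φ] C6} (hg : g.right ^ 2 = 1)
    (hh : h.right ^ 3 = 1) :
    (toTrivSqZeroExt hl hr g - 1) * (toTrivSqZeroExt hl hr h - 1) = 0 := by
  apply TrivSqZeroExt.ext
  · rw [TrivSqZeroExt.fst_mul, TrivSqZeroExt.fst_sub, TrivSqZeroExt.fst_sub,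
      TrivSqZeroExt.fst_one, TrivSqZeroExt.fst_zero, toTrivSqZeroExt_fst, toTrivSqZeroExt_fst]
    exact ofC6_sub_mul_sub _ _ hg (Or.inl hh)
  · rw [TrivSqZeroExt.snd_mul, TrivSqZeroExt.fst_sub, TrivSqZeroExt.fst_sub,
      TrivSqZeroExt.snd_sub, TrivSqZeroExt.snd_sub, TrivSqZeroExt.fst_one, TrivSqZeroExt.snd_one,
      sub_zero, sub_zero, op_sub, op_one, sub_smul, sub_smul, one_smul, one_smul,
      toTrivSqZeroExt_fst, toTrivSqZeroExt_fst, hl, hr, hh, map_one,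
      show g.right ^ 4 = (g.right ^ 2) ^ 2 from pow_mul _ 2 2, hg, one_pow, map_one]
    simp

/-- The left action of g.right is again trivial. On the right, h.right acts through h.right ^ 3 =
h.right, which fixes `g.left`. -/
theorem toTrivSqZeroExt_sub_mul_sub_of_sq {g h : A ⋊[φ] C6} (hg : g.right ^ 2 = 1)
    (hh : h.right ^ 2 = 1) (hgh : φ h.right g.left = g.left) :
    (toTrivSqZeroExt hl hr g - 1) * (toTrivSqZeroExt hl hr h - 1) = 0 := by
  apply TrivSqZeroExt.ext
  · rw [TrivSqZeroExt.fst_mul, TrivSqZeroExt.fst_sub, TrivSqZeroExt.fst_sub,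
      TrivSqZeroExt.fst_one, TrivSqZeroExt.fst_zero, toTrivSqZeroExt_fst, toTrivSqZeroExt_fst]
    exact ofC6_sub_mul_sub _ _ hg (Or.inr hh)
  · rw [TrivSqZeroExt.snd_mul, TrivSqZeroExt.fst_sub, TrivSqZeroExt.fst_sub,
      TrivSqZeroExt.snd_sub, TrivSqZeroExt.snd_sub, TrivSqZeroExt.fst_one, TrivSqZeroExt.snd_one,
      sub_zero, sub_zero, op_sub, op_one, sub_smul, sub_smul, one_smul, one_smul,
      toTrivSqZeroExt_fst, toTrivSqZeroExt_fst, hl, hr, toTrivSqZeroExt_snd hl hr g, toMul_ofMul,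
      aut_mul_apply, mul_comm, ← aut_mul_apply, pow_succ h.right, hh, one_mul, hgh,
      show g.right ^ 4 = (g.right ^ 2) ^ 2 from pow_mul _ 2 2, hg, one_pow, map_one]
    simp

theorem exists_ringHom_toTrivSqZeroExt (hA : ∀ a : A, a ^ 2 = 1)
    (hfix : ∀ a : A, φ (x ^ 2) a = a → φ (x ^ 3) a = a) (f : A ⋊[φ] C6 →* A ⋊[φ] C6) :
    ∃ F : TrivSqZeroExt C6Ring (Additive A) →+* TrivSqZeroExt C6Ring (Additive A),
      ∀ g, F (toTrivSqZeroExt hl hr g) = toTrivSqZeroExt hl hr (f g) := by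
  set E := toTrivSqZeroExt hl hr
  have h2 : (2 : TrivSqZeroExt C6Ring (Additive A)) = 0 := by
    rw [← TrivSqZeroExt.inl_zero, ← two_eq_zero]
    rfl
  have hright : ∀ (g : A ⋊[φ] C6) (n : ℕ), g ^ n = 1 → g.right ^ n = 1 := fun g n hg => by
    rw [← SemidirectProduct.rightHom_eq_right, ← map_pow, hg, map_one]
  have hinl : ∀ a, (f (SemidirectProduct.inl a)) ^ 2 = 1 := fun a => by
    rw [← map_pow, ← map_pow, hA, map_one, map_one]
  have hinr : ∀ (k : C6) (m n : ℕ), m * n = 6 → (f (SemidirectProduct.inr (k ^ m))) ^ n = 1 :=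
    fun k m n hmn => by
      rw [← map_pow, ← map_pow, ← pow_mul, hmn, pow_six, map_one, map_one]
  have hinr4 : ∀ k : C6, (f (SemidirectProduct.inr (k ^ 4))).right ^ 3 = 1 := fun k => by
    rw [show k ^ 4 = (k ^ 2) ^ 2 from pow_mul k 2 2]
    exact hright _ _ (hinr _ _ _ rfl)
  have rel1 : ∀ a b, (E (f (SemidirectProduct.inl a)) - 1) * (E (f (SemidirectProduct.inl b)) - 1)
      = 0 := fun a b =>
    toTrivSqZeroExt_sub_mul_sub_of_sq hl hr (hright _ _ (hinl a)) (hright _ _ (hinl b))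
      (aut_right_left_of_commute hA (hinl a) (hinl b) (by
        rw [← map_mul, ← map_mul, mul_comm, map_mul, map_mul]))
  have rel2 : ∀ (k : C6) (a : A), (E (f (SemidirectProduct.inr (k ^ 3))) - 1) *
      (E (f (SemidirectProduct.inl a)) - 1) = 0 := by
    intro k a
    refine toTrivSqZeroExt_sub_mul_sub_of_sq hl hr (hright _ _ (hinr _ 3 2 rfl))
      (hright _ _ (hinl a)) ?_
    -- The norm of `a` under x ^ 2 replaces `a`: it is fixed by x ^ 2, hence by x ^ 3 through
    -- `hfix`, so it commutes with k ^ 3. Its image under `f` has the same right component as that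
    -- of `a`, because conjugates share right components and an involution equals its cube.
    set b : A := a * φ (x ^ 2) a * φ (x ^ 4) a with hb
    have hb2 : φ (x ^ 2) b = b := by
      rw [hb, map_mul, map_mul, aut_mul_apply, aut_mul_apply, ← pow_add, ← pow_add, pow_six,
        map_one, MulAut.one_apply, mul_comm _ a, mul_assoc]
    have hconj : ∀ l : C6, (f (SemidirectProduct.inl (φ l a))).right =
        (f (SemidirectProduct.inl a)).right := fun l => by
      rw [SemidirectProduct.inl_aut, map_mul, map_mul, SemidirectProduct.mul_right,
        SemidirectProduct.mul_right, mul_right_comm, ← SemidirectProduct.mul_right, ← map_mul,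
        ← map_mul, mul_inv_cancel, map_one, map_one, SemidirectProduct.one_right, one_mul]
    have hbr : (f (SemidirectProduct.inl b)).right = (f (SemidirectProduct.inl a)).right := by
      rw [hb, map_mul, map_mul, map_mul, map_mul, SemidirectProduct.mul_right,
        SemidirectProduct.mul_right, hconj, hconj, ← sq, hright _ _ (hinl a), one_mul]
    rw [← hbr]
    refine aut_right_left_of_commute hA (hinr _ 3 2 rfl) (hinl b) ?_
    have hkb : φ (k ^ 3) b = b := by
      rcases x_pow_three_cases (k ^ 3) (by rw [← pow_mul, pow_six]) with h | h
      · rw [h, map_one, MulAut.one_apply]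
      · rw [h, hfix b hb2]
    have hcomm := SemidirectProduct.inl_aut (φ := φ) (k ^ 3) b
    rw [hkb, map_inv, eq_mul_inv_iff_mul_eq] at hcomm
    rw [← map_mul, ← map_mul, hcomm]
  have rel3 : ∀ (k : C6) (a : A), (E (f (SemidirectProduct.inl a)) - 1) *
      (E (f (SemidirectProduct.inr (k ^ 4))) - 1) = 0 := fun k a =>
    toTrivSqZeroExt_sub_mul_sub_of_pow_three hl hr (hright _ _ (hinl a)) (hinr4 k)
  have rel4 : (E (f (SemidirectProduct.inr (x ^ 3))) - 1) *
      (E (f (SemidirectProduct.inr (x ^ 4))) - 1) = 0 :=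
    toTrivSqZeroExt_sub_mul_sub_of_pow_three hl hr (hright _ _ (hinr _ 3 2 rfl)) (hinr4 x)
  set y := E (f (SemidirectProduct.inr x)) with hy
  have hypow : ∀ n : ℕ, E (f (SemidirectProduct.inr (x ^ n))) = y ^ n := fun n => by
    rw [map_pow, map_pow, map_pow]
  have hchar : ∀ z : TrivSqZeroExt C6Ring (Additive A), -z = z := fun z =>
    neg_eq_of_add_eq_zero_left (by rw [← two_mul, h2, zero_mul])
  -- Since y ^ 7 = y, the relation (y ^ 3 - 1)(y ^ 4 - 1) = 0 is the defining equation of `C6Ring`.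
  have hy4 : y ^ 4 = y ^ 3 + y + 1 := by
    rw [hypow, hypow, sub_mul, mul_sub, ← pow_add,
      show y ^ (3 + 4) = y by rw [← hypow]; rfl, mul_one, one_mul] at rel4
    calc y ^ 4 = -(y - y ^ 3 - (y ^ 4 - 1)) + (y + -y ^ 3 + 1) := by abel
      _ = y ^ 3 + y + 1 := by rw [rel4, hchar, zero_add, hchar, add_comm y]
  obtain ⟨σ, hσ⟩ := exists_addMonoidHom h2 y hy4
  have hσ' : ∀ k : C6, σ (ofC6 k) = E (f (SemidirectProduct.inr k)) := fun k => by
    obtain ⟨n, rfl⟩ := exists_pow_eq k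
    rw [hσ, hypow]
    fin_cases n <;> rfl
  -- Only additivity is needed here. On the summand `A`, it is the relation `rel1`.
  let F : TrivSqZeroExt C6Ring (Additive A) →+ TrivSqZeroExt C6Ring (Additive A) :=
    { toFun := fun z => σ z.fst + (E (f (SemidirectProduct.inl z.snd.toMul)) - 1)
      map_zero' := by simp
      map_add' := fun z w => by
        have := rel1 z.snd.toMul w.snd.toMul
        rw [TrivSqZeroExt.fst_add, map_add, TrivSqZeroExt.snd_add, toMul_add, map_mul, map_mul,
          map_mul, ← sub_eq_zero, ← this]
        noncomm_ring }
  refine exists_ringHom_of_addMonoidHom E (closure_range_toTrivSqZeroExt hl hr) f F fun g => ?_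
  change σ (E g).fst + (E (f (SemidirectProduct.inl (E g).snd.toMul)) - 1) = _
  rw [toTrivSqZeroExt_fst, toTrivSqZeroExt_snd, toMul_ofMul, hσ']
  obtain ⟨a, k⟩ := g
  dsimp only
  have hconj : SemidirectProduct.inl a * SemidirectProduct.inr (k ^ 3) =
      SemidirectProduct.inr (k ^ 3) * (SemidirectProduct.inl (φ (k ^ 3) a) : A ⋊[φ] C6) := by
    ext
    · simp only [SemidirectProduct.mul_left, SemidirectProduct.left_inl,
        SemidirectProduct.left_inr, SemidirectProduct.right_inl, SemidirectProduct.right_inr,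
        map_one, mul_one, one_mul, aut_mul_apply]
      rw [← pow_add, pow_six, map_one, MulAut.one_apply]
    · simp
  set p := E (f (SemidirectProduct.inl a)) with hp
  set q := E (f (SemidirectProduct.inl (φ (k ^ 3) a))) with hq
  set r := E (f (SemidirectProduct.inr (k ^ 3))) with hr'
  set s := E (f (SemidirectProduct.inr (k ^ 4))) with hs
  have e1 : p * r = r * q := by
    rw [hp, hr', hq, ← map_mul, ← map_mul, hconj, map_mul, map_mul]
  have e2 : (r - 1) * (q - 1) = 0 := rel2 k _
  have e3 : (q - 1) * (s - 1) = 0 := rel3 k _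
  have e4 : E (f (SemidirectProduct.inr k)) = r * s := by
    rw [hr', hs, ← map_mul, ← map_mul, ← map_mul, ← eq_pow_three_mul_pow_four]
  have e5 : E (f ⟨a, k⟩) = p * (r * s) := by
    rw [SemidirectProduct.mk_eq_inl_mul_inr, map_mul, map_mul, e4]
  have e6 : r * q = r + q - 1 := by
    rw [← sub_eq_zero, ← e2]
    noncomm_ring
  have e7 : q * s = q + s - 1 := by
    rw [← sub_eq_zero, ← e3]
    noncomm_ring
  -- The goal is r s + (q - 1) = p r s, and p r s = r q s = (r + q - 1) s = r s + q - 1.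
  rw [e4, e5, ← mul_assoc, e1, e6, sub_mul, add_mul, e7, one_mul]
  abel

end

/-- Over 𝔽₂ both X³ + 1 and X² + 1 divide X⁴ + X³ + X + 1. The signs match the hypothesis of
`moduleOf`. -/
theorem aut_toAdditive_relation {A : Type u} [CommGroup A] (hA : ∀ a : A, a ^ 2 = 1)
    (φ : C6 →* MulAut A) (l : C6) (hl : l ^ 3 = 1 ∨ l ^ 2 = 1) (a : A) :
    φ l (φ l (φ l (φ l a))) = (φ l (φ l (φ l a)))⁻¹ / φ l a / a := by
  have hinv : ∀ a : A, a⁻¹ = a := fun a => inv_eq_of_mul_eq_one_left (by rw [← sq, hA])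
  simp only [aut_mul_apply, div_eq_mul_inv, hinv]
  rcases hl with hl | hl
  · rw [← pow_three, hl, mul_one, map_one, MulAut.one_apply, mul_right_comm, ← sq, hA, one_mul]
  · rw [← sq l, hl, mul_one, ← sq, hl, map_one, MulAut.one_apply, ← sq, hA, one_mul]

theorem fullyRealizable_of_fixed {A : Type u} [CommGroup A] [Finite A] (hA : ∀ a : A, a ^ 2 = 1)
    (φ : C6 →* MulAut A) (hfix : ∀ a : A, φ (x ^ 2) a = a → φ (x ^ 3) a = a) :
    FullyRealizable.{u, v} (A ⋊[φ] C6) := by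
  let _ : Module (ZMod 2) (Additive A) := AddCommGroup.zmodModule fun a => hA a.toMul
  let T : C6 → Additive A →ₗ[ZMod 2] Additive A := fun l =>
    (MulEquiv.toAdditive (φ l)).toAddMonoidHom.toZModLinearMap 2
  have hT3 : ∀ m, T (x ^ 3) (T (x ^ 3) (T (x ^ 3) (T (x ^ 3) m))) =
      -T (x ^ 3) (T (x ^ 3) (T (x ^ 3) m)) - T (x ^ 3) m - m :=
    fun m => aut_toAdditive_relation hA φ _ (Or.inr rfl) m.toMul
  have hT4 : ∀ m, T (x ^ 4) (T (x ^ 4) (T (x ^ 4) (T (x ^ 4) m))) =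
      -T (x ^ 4) (T (x ^ 4) (T (x ^ 4) m)) - T (x ^ 4) m - m :=
    fun m => aut_toAdditive_relation hA φ _ (Or.inl rfl) m.toMul
  let ml : Module C6Ring (Additive A) :=
    moduleOf (T (x ^ 4)) hT4
  let mr : Module C6Ringᵐᵒᵖ (Additive A) :=
    @Module.compHom _ _ _ _ _
      (moduleOf (T (x ^ 3)) hT3) _ ((RingEquiv.toOpposite C6Ring).symm : C6Ringᵐᵒᵖ →+* C6Ring)
  have hl : ∀ (k : C6) (a : Additive A), ofC6 k • a = Additive.ofMul (φ (k ^ 4) a.toMul) := by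
    intro k
    obtain ⟨n, rfl⟩ := exists_pow_eq k
    generalize (n : ℕ) = n
    induction n with
    | zero => intro a; simp
    | succ n ih =>
      intro a
      have hX : X • a = Additive.ofMul (φ (x ^ 4) a.toMul) :=
        moduleOf_X_smul (T (x ^ 4)) hT4 a
      rw [pow_succ, map_mul, mul_smul, show ofC6 x = X by decide, hX, ih, toMul_ofMul,
        aut_mul_apply, mul_pow]
  have hr : ∀ (k : C6) (a : Additive A), op (ofC6 k) • a = Additive.ofMul (φ (k ^ 3) a.toMul) := by
    intro k
    obtain ⟨n, rfl⟩ := exists_pow_eq k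
    generalize (n : ℕ) = n
    induction n with
    | zero => intro a; simp
    | succ n ih =>
      intro a
      have hX : op X • a = Additive.ofMul (φ (x ^ 3) a.toMul) :=
        moduleOf_X_smul (T (x ^ 3)) hT3 a
      rw [pow_succ', map_mul, op_mul, mul_smul, show ofC6 x = X by decide, hX, ih, toMul_ofMul,
        aut_mul_apply, mul_pow, mul_comm]
  have hcomm : SMulCommClass C6Ring C6Ringᵐᵒᵖ (Additive A) := by
    refine ⟨fun s t a => ?_⟩
    have hs : s ∈ AddSubgroup.closure (Set.range ofC6) := closure_range_ofC6 ▸ AddSubgroup.mem_top s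
    obtain ⟨t, rfl⟩ := op_surjective t
    have ht : t ∈ AddSubgroup.closure (Set.range ofC6) := closure_range_ofC6 ▸ AddSubgroup.mem_top t
    induction hs using AddSubgroup.closure_induction with
    | mem s hs =>
      obtain ⟨k, rfl⟩ := hs
      induction ht using AddSubgroup.closure_induction with
      | mem t ht =>
        obtain ⟨l, rfl⟩ := ht
        rw [hl, hr, hl, hr, toMul_ofMul, toMul_ofMul, aut_mul_apply, aut_mul_apply, mul_comm]
      | zero => simp
      | add t t' _ _ h h' => rw [op_add, add_smul, add_smul, smul_add, h, h']
      | neg t _ h => rw [op_neg, neg_smul, neg_smul, smul_neg, h]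
    | zero => simp
    | add s s' _ _ h h' => rw [add_smul, add_smul, smul_add, h, h']
    | neg s _ h => rw [neg_smul, neg_smul, smul_neg, h]
  have : Finite (TrivSqZeroExt C6Ring (Additive A)) :=
    inferInstanceAs (Finite (C6Ring × Additive A))
  let e : A ⋊[φ] C6 ≃* (TrivSqZeroExt C6Ring (Additive A))ˣ :=
    MulEquiv.ofBijective (toTrivSqZeroExt hl hr).toHomUnits
      ⟨fun g h hgh => toTrivSqZeroExt_injective hl hr (congrArg Units.val hgh), fun z => by
        obtain ⟨g, hg⟩ := exists_toTrivSqZeroExt_eq hl hr z.isUnit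
        exact ⟨g, Units.ext hg⟩⟩
  exact FullyRealizable.of_finite e fun f => exists_ringHom_toTrivSqZeroExt hl hr hA hfix f

end C6

/-! ### Splitting off `Q` as a direct summand -/

namespace C6

section

variable {Γ M A : Type*} [Group Γ] [CommGroup M] [CommGroup A] {ψ : Γ →* MulAut M}
  {φ : Γ →* MulAut A}

/-- `A` is the product of the range of `i` and the kernel of `p`. Bijectivity of `p.comp i` replaces
the identity so that a triangular composite is enough. -/
theorem _root_.IsDirectSummand.of_bijective (i : M →* A) (p : A →* M)
    (hi : ∀ g m, i (ψ g m) = φ g (i m)) (hp : ∀ g a, p (φ g a) = ψ g (p a))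
    (h : Function.Bijective (p.comp i)) : IsDirectSummand ψ φ := by
  have hinj : Function.Injective i := fun m n hmn => h.1 (congrArg p hmn)
  refine ⟨i.range, p.ker, ⟨?_, ?_⟩, ?_, ?_, MonoidHom.ofInjective hinj, fun g m => hi g m⟩
  · rw [Subgroup.disjoint_def]
    rintro _ ⟨m, rfl⟩ hm
    rw [h.1 ((MonoidHom.mem_ker.1 hm).trans (map_one (p.comp i)).symm), map_one]
  · rw [codisjoint_iff, eq_top_iff]
    intro a _
    obtain ⟨m, hm⟩ := h.2 (p a)
    rw [← mul_inv_cancel_left (i m) a]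
    refine Subgroup.mul_mem_sup ⟨m, rfl⟩ ?_
    rw [MonoidHom.mem_ker, map_mul, map_inv, ← hm, MonoidHom.comp_apply, inv_mul_cancel]
  · rintro g _ ⟨m, rfl⟩
    exact ⟨ψ g m, hi g m⟩
  · intro g c hc
    rw [MonoidHom.mem_ker] at hc ⊢
    rw [hp, hc, map_one]

theorem _root_.IsDirectSummand.exists_retraction (h : IsDirectSummand ψ φ) :
    ∃ (i : M →* A) (p : A →* M), (∀ g m, i (ψ g m) = φ g (i m)) ∧
      (∀ g a, p (φ g a) = ψ g (p a)) ∧ ∀ m, p (i m) = m := by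
  obtain ⟨B, C, hBC, hB, hC, e, he⟩ := h
  let s : B × C →* A := B.subtype.coprod C.subtype
  have hs : ∀ b c, s (b, c) = b * c := fun _ _ => rfl
  have hbij : Function.Bijective s := by
    constructor
    · rw [injective_iff_map_eq_one]
      rintro ⟨b, c⟩ hbc
      rw [hs] at hbc
      have hb : (b : A) = 1 := Subgroup.disjoint_def.1 hBC.disjoint b.2
        (by rw [eq_inv_of_mul_eq_one_left hbc]; exact inv_mem c.2)
      rw [hb, one_mul] at hbc
      exact Prod.ext (Subtype.ext hb) (Subtype.ext hbc)
    · intro a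
      have ha : a ∈ B ⊔ C := by rw [hBC.sup_eq_top]; exact Subgroup.mem_top a
      obtain ⟨b, hb, c, hc, rfl⟩ := Subgroup.mem_sup.1 ha
      exact ⟨(⟨b, hb⟩, ⟨c, hc⟩), rfl⟩
  let E : B × C ≃* A := MulEquiv.ofBijective s hbij
  have hE : ∀ z, E.symm (s z) = z := fun z => E.symm_apply_apply z
  refine ⟨B.subtype.comp e, (e.symm : B →* M).comp ((MonoidHom.fst B C).comp E.symm), he, ?_, ?_⟩
  · intro g a
    obtain ⟨⟨b, c⟩, rfl⟩ := hbij.2 a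
    have h1 : φ g (s (b, c)) = s (⟨φ g b, hB g b b.2⟩, ⟨φ g c, hC g c c.2⟩) := by
      rw [hs, hs, map_mul]
    change e.symm (E.symm _).1 = ψ g (e.symm (E.symm _).1)
    rw [h1, hE, hE, MulEquiv.symm_apply_eq]
    ext
    rw [he, MulEquiv.apply_symm_apply]
  · intro m
    have h1 : (e m : A) = s (e m, 1) := by rw [hs, Subgroup.coe_one, mul_one]
    change e.symm (E.symm (e m : A)).1 = m
    rw [h1, hE, MulEquiv.symm_apply_apply]

end

theorem equivariant_of_x {M N : Type*} [Group M] [Group N] (ψ : C6 →* MulAut M)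
    (φ : C6 →* MulAut N) (f : M →* N) (h : ∀ m, f (ψ x m) = φ x (f m)) (g : C6) (m : M) :
    f (ψ g m) = φ g (f m) := by
  obtain ⟨n, rfl⟩ := exists_pow_eq g
  generalize (n : ℕ) = n
  induction n with
  | zero => simp
  | succ n ih => rw [pow_succ', map_mul, map_mul, MulAut.mul_apply, MulAut.mul_apply, h, ih]

theorem QAction_x_apply : ∀ m : QGroup,
    QAction x m = Multiplicative.ofAdd (m.toAdd.1, m.toAdd.1 + m.toAdd.2) := by decide

/-- An element fixed by `x ^ 2` but not by `x ^ 3` generates a direct summand `Q`. -/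
theorem isDirectSummand_of_not_fixed {A : Type u} [CommGroup A] (hA : ∀ a : A, a ^ 2 = 1)
    (φ : C6 →* MulAut A) {q : A} (hq2 : φ (x ^ 2) q = q) (hq3 : φ (x ^ 3) q ≠ q) :
    IsDirectSummand QAction φ := by
  let _ : Module (ZMod 2) (Additive A) := AddCommGroup.zmodModule fun a => hA a.toMul
  have hinv : ∀ a : A, a⁻¹ = a := fun a => inv_eq_of_mul_eq_one_left (by rw [← sq, hA])
  have h2 : ∀ c : ZMod 2, c + c = 0 := by decide
  set z : A := q * φ (x ^ 3) q with hz
  clear_value z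
  have hz1 : z ≠ 1 := fun h => hq3 (by rw [eq_inv_of_mul_eq_one_right (hz.symm.trans h), hinv])
  have hq4 : φ (x ^ 4) q = q := by
    rw [show (x ^ 4 : C6) = x ^ 2 * x ^ 2 from rfl, ← aut_mul_apply, hq2, hq2]
  have hxq : φ x q = φ (x ^ 3) q := by
    rw [eq_pow_three_mul_pow_four x, ← aut_mul_apply, hq4, ← eq_pow_three_mul_pow_four]
  have hxz : φ x z = z := by
    rw [hz, map_mul, hxq, aut_mul_apply, show (x * x ^ 3 : C6) = x ^ 4 from rfl, hq4, mul_comm]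
  have hnz : ∀ n : ℕ, φ (x ^ n) z = z := fun n => by
    induction n with
    | zero => simp
    | succ n ih => rw [pow_succ, ← aut_mul_apply, hxz, ih]
  obtain ⟨l, hl⟩ : ∃ l : Module.Dual (ZMod 2) (Additive A), l (Additive.ofMul z) ≠ 0 := by
    by_contra! h
    exact hz1 (Additive.ofMul.injective ((Module.forall_dual_apply_eq_zero_iff (ZMod 2) _).1 h))
  let n : A →* A := MonoidHom.id A * (φ (x ^ 2)).toMonoidHom * (φ (x ^ 4)).toMonoidHom
  have hn : ∀ a, n a = a * φ (x ^ 2) a * φ (x ^ 4) a := fun _ => rfl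
  -- Composing with the norm of ⟨x ^ 2⟩ makes the functional x ^ 2-invariant; as 3 is odd, its value
  -- at `z` remains nonzero.
  let m : A → ZMod 2 := fun a => l (Additive.ofMul (n a))
  have hm_mul : ∀ a b, m (a * b) = m a + m b := fun a b => by
    simp only [m, map_mul, ofMul_mul, map_add]
  have hm_x : ∀ a, m (φ x a) = m (φ (x ^ 3) a) := fun a => by
    simp only [m, hn, aut_mul_apply, ← pow_add, ← pow_succ]
    rw [show x ^ (4 + 3) = x from rfl, mul_comm (φ x a), mul_right_comm]
  have hm_x3 : ∀ a, m (φ (x ^ 3) (φ x a)) = m a := fun a => by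
    simp only [m, hn, aut_mul_apply, ← pow_add, ← pow_succ]
    rw [show x ^ (2 + (3 + 1)) = 1 from rfl, show x ^ (4 + (3 + 1)) = x ^ 2 from rfl, map_one,
      MulAut.one_apply, mul_comm _ a, mul_right_comm]
  have hm_z : m z = 1 := by
    have : ∀ c : ZMod 2, c ≠ 0 → c + c + c = 1 := by decide
    simp only [m, hn, hnz, ofMul_mul, map_add]
    exact this _ hl
  have hm_pow : ∀ (a : A) (c : ZMod 2), m (a ^ c.val) = c * m a := by
    intro a c
    have hc : ∀ c : ZMod 2, c = 0 ∨ c = 1 := by decide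
    rcases hc c with rfl | rfl
    · simp [m]
    · rw [ZMod.val_one, pow_one, one_mul]
  have hpow_add : ∀ (a : A) (c d : ZMod 2), a ^ (c + d).val = a ^ c.val * a ^ d.val :=
    fun a c d => by rw [ZMod.val_add, ← pow_add, ← pow_eq_pow_mod _ (hA a)]
  let i : QGroup →* A :=
    { toFun := fun w => q ^ w.toAdd.1.val * z ^ w.toAdd.2.val
      map_one' := by simp
      map_mul' := fun w w' => by
        rw [toAdd_mul, Prod.fst_add, Prod.snd_add, hpow_add, hpow_add, mul_mul_mul_comm] }
  have hi : ∀ w, i w = q ^ w.toAdd.1.val * z ^ w.toAdd.2.val := fun _ => rfl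
  -- `Q` is coinduced from the trivial module of ⟨x ^ 2⟩, so the invariant functional `m` determines
  -- an equivariant map to `Q` with coordinates m(a) + m(x ^ 3 a) and m(a).
  let p : A →* QGroup :=
    { toFun := fun a => Multiplicative.ofAdd (m a + m (φ (x ^ 3) a), m a)
      map_one' := by simp [m]
      map_mul' := fun a b => by
        rw [map_mul, hm_mul, hm_mul, add_add_add_comm]
        rfl }
  refine IsDirectSummand.of_bijective i p (equivariant_of_x _ _ i ?_) (equivariant_of_x _ _ p ?_) ?_
  · intro w
    have hqz : φ x q = q * z := by rw [hxq, hz, ← mul_assoc, ← sq, hA, one_mul]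
    rw [QAction_x_apply, hi, hi, map_mul (φ x), map_pow (φ x), map_pow (φ x), hxz, hqz, mul_pow,
      toAdd_ofAdd]
    dsimp only
    rw [hpow_add z, mul_assoc]
  · intro a
    rw [QAction_x_apply]
    change Multiplicative.ofAdd (m (φ x a) + m (φ (x ^ 3) (φ x a)), m (φ x a)) =
      Multiplicative.ofAdd (m a + m (φ (x ^ 3) a), m a + m (φ (x ^ 3) a) + m a)
    rw [hm_x3, hm_x, add_comm (m a), add_assoc, h2, add_zero]
  · have hpi : ∀ w, p.comp i w =
        Multiplicative.ofAdd (w.toAdd.1, w.toAdd.1 * m q + w.toAdd.2) := by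
      intro w
      have h1 : m q + m (φ (x ^ 3) q) = 1 := by rw [← hm_mul, ← hz, hm_z]
      change Multiplicative.ofAdd (m (i w) + m (φ (x ^ 3) (i w)), m (i w)) = _
      rw [hi, map_mul (φ (x ^ 3)), map_pow (φ (x ^ 3)), map_pow (φ (x ^ 3)), hnz, hm_mul, hm_mul, hm_pow, hm_pow, hm_pow, hm_z,
        add_add_add_comm, h2, ← mul_add, h1, mul_one, mul_one, add_zero]
    have : ∀ c : ZMod 2, Function.Bijective
        (fun w : QGroup => Multiplicative.ofAdd (w.toAdd.1, w.toAdd.1 * c + w.toAdd.2)) := by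
      unfold Function.Bijective Function.Injective Function.Surjective
      decide
    convert this (m q) using 1
    exact funext hpi

/-! ### The obstruction when `Q` is a direct summand -/

/-- The endomorphism of `Q ⋊ C6` with kernel `⟨x ^ 2⟩` that exchanges `a` and `x ^ 3`. -/
def QSwap : QGroup ⋊[QAction] C6 →* QGroup ⋊[QAction] C6 :=
  SemidirectProduct.lift
    { toFun := fun m => ⟨Multiplicative.ofAdd (0, m.toAdd.2), x ^ (3 * m.toAdd.1.val)⟩
      map_one' := by decide
      map_mul' := by decide }
    { toFun := fun k => ⟨Multiplicative.ofAdd ((k.toAdd.val : ZMod 2), 0), 1⟩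
      map_one' := by decide
      map_mul' := by decide }
    (by
      intro g
      apply MonoidHom.ext
      revert g
      decide)

/-- The endomorphism of `Q ⋊ C6` that kills `Q` and `x ^ 2`. -/
def QKill : QGroup ⋊[QAction] C6 →* QGroup ⋊[QAction] C6 :=
  SemidirectProduct.inr.comp ((powMonoidHom 3).comp SemidirectProduct.rightHom)

/-- The fixed points of `QSwap` are just ⟨b⟩: exchanging the two generating involutions of the
dihedral group inverts its rotations and fixes no reflection. -/
theorem QKill_eq_one_of_QSwap_eq : ∀ g, QSwap g = g → QKill g = 1 := by
  rintro ⟨a, k⟩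
  revert a k
  decide +kernel

/-- The square is 1 + st + ts. As st and ts are mutually inverse, squaring again gives 1 + (st)² +
(ts)² + 2, which is 1 because (st)² = (ts)². -/
theorem pow_four_eq_one_of_involutions {R : Type*} [Ring R] (h2 : (2 : R) = 0) {s t : R}
    (hs : s * s = 1) (ht : t * t = 1) (hst : s * t * (s * t) = t * s * (t * s)) :
    (1 + s + t) ^ 4 = 1 := by
  have h2' : ∀ z : R, z + z = 0 := fun z => by rw [← two_mul, h2, zero_mul]
  have e1 : (1 + s + t) ^ 2 = 1 + s * t + t * s := by
    calc (1 + s + t) ^ 2 = 1 + s * t + t * s + ((s + s) + (t + t)) + (s * s + t * t) := by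
          noncomm_ring
      _ = _ := by rw [h2' s, h2' t, hs, ht, h2' 1, add_zero, add_zero, add_zero]
  have e2 : s * t * (t * s) = 1 := by rw [mul_assoc, ← mul_assoc t, ht, one_mul, hs]
  have e3 : t * s * (s * t) = 1 := by rw [mul_assoc, ← mul_assoc s, hs, one_mul, ht]
  rw [show 4 = 2 * 2 from rfl, pow_mul, e1]
  calc (1 + s * t + t * s) ^ 2 = 1 + ((s * t + s * t) + (t * s + t * s)) +
        (s * t * (s * t) + t * s * (t * s)) + (s * t * (t * s) + t * s * (s * t)) := by
        noncomm_ring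
    _ = _ := by rw [h2' (s * t), h2' (t * s), hst, h2' (t * s * (t * s)), e2, e3, h2' 1, add_zero,
        add_zero, add_zero, add_zero]

theorem not_fullyRealizable_of_isDirectSummand {A : Type u} [CommGroup A]
    (φ : C6 →* MulAut A) (h : IsDirectSummand QAction φ) :
    ¬ FullyRealizable.{u, v} (A ⋊[φ] C6) := by
  rintro ⟨R, _, e, hR⟩
  obtain ⟨i, p, hi, hp, hpi⟩ := h.exists_retraction
  let I : QGroup ⋊[QAction] C6 →* A ⋊[φ] C6 :=
    SemidirectProduct.map i (MonoidHom.id C6) fun g => MonoidHom.ext fun m => hi g m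
  let P : A ⋊[φ] C6 →* QGroup ⋊[QAction] C6 :=
    SemidirectProduct.map p (MonoidHom.id C6) fun g => MonoidHom.ext fun a => hp g a
  have hPI : ∀ g, P (I g) = g := fun g => SemidirectProduct.ext (hpi _) rfl
  have hIinj : Function.Injective I := Function.LeftInverse.injective hPI
  have h2 : (2 : R) = 0 := by
    -- The ring map inducing the trivial endomorphism sends the unit -1 to 1, but it also fixes -1.
    obtain ⟨F, hF⟩ := hR 1
    have h1 := congrArg Units.val (hF (e.symm (-1)))
    simp only [MulEquiv.apply_symm_apply, MonoidHom.one_apply, map_one, Units.coe_map,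
      Units.val_neg, Units.val_one, MonoidHom.coe_coe, map_neg] at h1
    rw [← one_add_one_eq_two]
    nth_rewrite 1 [← h1]
    rw [neg_add_cancel]
  let t : QGroup ⋊[QAction] C6 := SemidirectProduct.inr (x ^ 3)
  let q : QGroup ⋊[QAction] C6 := SemidirectProduct.inl (Multiplicative.ofAdd (1, 0))
  let E : QGroup ⋊[QAction] C6 →* R := (Units.coeHom R).comp ((e : _ →* Rˣ).comp I)
  have hu : (1 + E t + E q) ^ 4 = 1 := by
    refine pow_four_eq_one_of_involutions h2 ?_ ?_ ?_
    · rw [← map_mul, show t * t = 1 by decide, map_one]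
    · rw [← map_mul, show q * q = 1 by decide, map_one]
    · rw [← map_mul, ← map_mul, ← map_mul, ← map_mul,
        show t * q * (t * q) = q * t * (q * t) by decide]
  obtain ⟨u, hu'⟩ := IsUnit.of_pow_eq_one hu (by norm_num)
  set g := P (e.symm u)
  have key : ∀ f : QGroup ⋊[QAction] C6 →* QGroup ⋊[QAction] C6,
      1 + E (f t) + E (f q) = E (f g) := by
    intro f
    -- The retraction extends `f` to the whole group, so a ring map induces it and can be applied to
    -- 1 + t + q.
    obtain ⟨F, hF⟩ := hR (I.comp (f.comp P))
    have hF' : ∀ b : QGroup ⋊[QAction] C6, F (E b) = E (f b) := fun b => by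
      have h1 := congrArg Units.val (hF (I b))
      simp only [MonoidHom.comp_apply, hPI] at h1
      exact h1
    have h1 := congrArg Units.val (hF (e.symm u))
    rw [MulEquiv.apply_symm_apply, Units.coe_map, hu'] at h1
    rw [← hF', ← hF', ← map_one F, ← map_add, ← map_add]
    exact h1
  have hEinj : Function.Injective E := fun a b hab => hIinj (e.injective (Units.ext hab))
  have k1 := key (MonoidHom.id _)
  have k2 := key QSwap
  have k3 := key QKill
  rw [show QSwap t = q by decide, show QSwap q = t by decide, add_right_comm] at k2
  have hfix : QSwap g = g := hEinj (k2.symm.trans k1)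
  -- `QKill` fixes `t` and sends `q` to 1, so its equation becomes 1 + E t + 1 = 1, that is E t = 1.
  rw [QKill_eq_one_of_QSwap_eq g hfix, show QKill t = t by decide, show QKill q = 1 by decide,
    map_one, add_right_comm, one_add_one_eq_two, h2, zero_add] at k3
  exact absurd (hEinj (k3.trans (map_one E).symm)) (by decide)

end C6

/-! ### The criterion, the groups `H ⋊ C3`, and the example of order 96 -/

namespace C6

theorem fullyRealizable_iff {A : Type u} [CommGroup A] [Finite A] (hA : ∀ a : A, a ^ 2 = 1)
    (φ : C6 →* MulAut A) :
    FullyRealizable.{u, v} (A ⋊[φ] C6) ↔ ¬ IsDirectSummand QAction φ := by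
  refine ⟨fun h hQ => not_fullyRealizable_of_isDirectSummand φ hQ h, fun h => ?_⟩
  refine fullyRealizable_of_fixed hA φ fun a ha => ?_
  by_contra ha'
  exact h (isDirectSummand_of_not_fixed hA φ ha ha')

section

variable {A : Type u} [CommGroup A] (φ : C6 →* MulAut A)

theorem x_pow_three_zpowers (s : Subgroup.zpowers (x ^ 3)) :
    (s : C6) = 1 ∨ (s : C6) = x ^ 3 := by
  refine x_pow_three_cases _ ?_
  obtain ⟨_, n, rfl⟩ := s
  change ((x ^ 3) ^ n) ^ 2 = 1
  rw [← zpow_natCast, zpow_comm, zpow_natCast, show (x ^ 3 : C6) ^ 2 = 1 from rfl, one_zpow]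

theorem isPGroup_semidirectC2 (hA : ∀ a : A, a ^ 2 = 1) : IsPGroup 2 (SemidirectC2 φ) := by
  intro g
  -- Squares land in `A`, which has exponent two, so fourth powers are trivial.
  refine ⟨2, ?_⟩
  have h1 : (g ^ 2).right = 1 := by
    rw [← SemidirectProduct.rightHom_eq_right, map_pow, SemidirectProduct.rightHom_eq_right]
    ext
    rcases x_pow_three_zpowers g.right with h | h <;> rw [Subgroup.coe_pow, h] <;> rfl
  have h2 : g ^ 2 = SemidirectProduct.inl (g ^ 2).left := SemidirectProduct.ext rfl h1
  rw [show 2 ^ 2 = 2 * 2 from rfl, pow_mul g 2 2, h2, ← map_pow, hA, map_one]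

theorem semidirectC2_not_commutative (h : φ (x ^ 3) ≠ 1) :
    ¬ ∀ g h : SemidirectC2 φ, g * h = h * g := by
  intro hc
  refine h (MulEquiv.ext fun a => ?_)
  have := congrArg SemidirectProduct.left (hc
    (SemidirectProduct.inr ⟨x ^ 3, Subgroup.mem_zpowers _⟩) (SemidirectProduct.inl a))
  simpa using this

def ofC3 : C3 →* C6 where
  toFun c := x ^ (4 * c.toAdd.val)
  map_one' := by decide
  map_mul' := by decide

/-- The action of the subgroup of order three of `C6` on `A ⋊ C2`. -/
def C3Action : C3 →* MulAut (SemidirectC2 φ) where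
  toFun c := SemidirectProduct.congr (φ (ofC3 c)) (MulEquiv.refl _) fun s => by
    ext a
    change φ (ofC3 c) (φ s a) = φ s (φ (ofC3 c) a)
    rw [aut_mul_apply, aut_mul_apply, mul_comm]
  map_one' := by
    ext g
    · change φ (ofC3 1) g.left = g.left
      rw [map_one, map_one, MulAut.one_apply]
    · rfl
  map_mul' c d := by
    ext g
    · change φ (ofC3 (c * d)) g.left = φ (ofC3 c) (φ (ofC3 d) g.left)
      rw [aut_mul_apply, map_mul]
    · rfl

theorem exists_zpowers_mul_ofC3 (k : C6) :
    ∃ (s : Subgroup.zpowers (x ^ 3)) (c : C3), (s : C6) * ofC3 c = k := by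
  have h : ∀ k : C6, ∃ (n : Fin 2) (c : C3), (x ^ 3) ^ (n : ℕ) * ofC3 c = k := by decide
  obtain ⟨n, c, rfl⟩ := h k
  exact ⟨⟨(x ^ 3) ^ (n : ℕ), Subgroup.pow_mem _ (Subgroup.mem_zpowers _) _⟩, c, rfl⟩

theorem nonempty_mulEquiv : Nonempty (SemidirectC2 φ ⋊[C3Action φ] C3 ≃* A ⋊[φ] C6) := by
  let f : SemidirectC2 φ ⋊[C3Action φ] C3 →* A ⋊[φ] C6 :=
    { toFun := fun g => ⟨g.left.left, g.left.right * ofC3 g.right⟩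
      map_one' := by
        ext
        · rfl
        · simp
      map_mul' := fun g h => by
        ext
        · change g.left.left * φ g.left.right (φ (ofC3 g.right) h.left.left) =
            g.left.left * φ (g.left.right * ofC3 g.right) h.left.left
          rw [aut_mul_apply]
        · change ((g.left.right * h.left.right : Subgroup.zpowers (x ^ 3)) : C6) *
            ofC3 (g.right * h.right) =
            g.left.right * ofC3 g.right * (h.left.right * ofC3 h.right)
          rw [map_mul, Subgroup.coe_mul, mul_mul_mul_comm] }
  refine ⟨MulEquiv.ofBijective f ⟨?_, ?_⟩⟩
  · rw [injective_iff_map_eq_one]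
    rintro ⟨⟨a, s⟩, c⟩ hg
    have ha : a = 1 := congrArg SemidirectProduct.left hg
    have hk : (s : C6) * ofC3 c = 1 := congrArg SemidirectProduct.right hg
    have hc : c = 1 := by
      have h : ∀ c, ofC3 c = 1 ∨ x ^ 3 * ofC3 c = 1 → c = 1 := by decide
      refine h c ?_
      rcases x_pow_three_zpowers s with h | h <;> rw [h] at hk
      · exact Or.inl (by rwa [one_mul] at hk)
      · exact Or.inr hk
    subst ha hc
    rw [map_one, mul_one] at hk
    rw [show s = 1 from Subtype.ext hk]
    rfl
  · rintro ⟨a, k⟩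
    obtain ⟨s, c, rfl⟩ := exists_zpowers_mul_ofC3 k
    exact ⟨⟨⟨a, s⟩, c⟩, rfl⟩

theorem exists_semidirect_C3_fullyRealizable [Finite A] (hA : ∀ a : A, a ^ 2 = 1)
    (h : ¬ IsDirectSummand QAction φ) :
    ∃ ψ : C3 →* MulAut (SemidirectC2 φ),
      Nonempty (SemidirectC2 φ ⋊[ψ] C3 ≃* A ⋊[φ] C6) ∧
      FullyRealizable.{u, v} (SemidirectC2 φ ⋊[ψ] C3) := by
  obtain ⟨e⟩ := nonempty_mulEquiv φ
  exact ⟨C3Action φ, ⟨e⟩, ((fullyRealizable_iff hA φ).2 h).of_mulEquiv e.symm⟩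

end

/-- In `Q` the element b is fixed by x ^ 2, whereas x ^ 2 has no nontrivial fixed point in Y ⊗ Q. So
`Q` does not even embed equivariantly. -/
theorem not_isDirectSummand_YQAction : ¬ IsDirectSummand QAction YQAction := by
  rintro ⟨B, C, -, -, -, e, he⟩
  have h1 := he (x ^ 2) (Multiplicative.ofAdd (0, 1))
  rw [show QAction (x ^ 2) (Multiplicative.ofAdd (0, 1)) = Multiplicative.ofAdd (0, 1) by
    decide] at h1
  have h2 : ∀ m : YQGroup, m = YQAction (x ^ 2) m → m = 1 := by decide +kernel
  have h3 : e (Multiplicative.ofAdd (0, 1)) = e 1 := by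
    rw [map_one]
    exact Subtype.ext (h2 _ h1)
  exact absurd (e.injective h3) (by decide)

theorem YQAction_x_pow_three_ne_one : YQAction (x ^ 3) ≠ 1 := by
  intro h
  exact absurd (DFunLike.congr_fun h (Multiplicative.ofAdd (1, 0, 0, 0))) (by decide)

theorem card_zpowers_x_pow_three : Nat.card (Subgroup.zpowers (x ^ 3)) = 2 := by
  rw [Nat.card_zpowers]
  exact orderOf_eq_prime rfl (by decide)

end C6

theorem theoremc6 :
    -- the criterion
    (∀ (A : Type u) [CommGroup A] [Finite A], (∀ a : A, a ^ 2 = 1) →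
      ∀ φ : C6 →* MulAut A,
        FullyRealizable.{u, v} (A ⋊[φ] C6) ↔ ¬ IsDirectSummand QAction φ) ∧
    -- the resulting groups `H ⋊ C_3` with `H = A ⋊ C_2` a nonabelian 2-group
    (∀ (A : Type u) [CommGroup A] [Finite A], (∀ a : A, a ^ 2 = 1) →
      ∀ φ : C6 →* MulAut A, ¬ IsDirectSummand QAction φ → φ (C6.x ^ 3) ≠ 1 →
        IsPGroup 2 (SemidirectC2 φ) ∧ (¬ ∀ g h : SemidirectC2 φ, g * h = h * g) ∧
        ∃ ψ : C3 →* MulAut (SemidirectC2 φ),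
          Nonempty (SemidirectC2 φ ⋊[ψ] C3 ≃* A ⋊[φ] C6) ∧
          FullyRealizable.{u, v} (SemidirectC2 φ ⋊[ψ] C3)) ∧
    -- the example of order 96 given by `Y ⊗ Q`
    (Nat.card (YQGroup ⋊[YQAction] C6) = 96 ∧
      Nat.card (SemidirectC2 YQAction) = 32 ∧
      (¬ ∀ g h : SemidirectC2 YQAction, g * h = h * g) ∧
      ∃ ψ : C3 →* MulAut (SemidirectC2 YQAction),
        Nonempty (SemidirectC2 YQAction ⋊[ψ] C3 ≃* YQGroup ⋊[YQAction] C6) ∧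
        FullyRealizable.{0, v} (SemidirectC2 YQAction ⋊[ψ] C3)) := by
  refine ⟨fun A _ _ hA φ => C6.fullyRealizable_iff hA φ, fun A _ _ hA φ h h3 =>
    ⟨C6.isPGroup_semidirectC2 φ hA, C6.semidirectC2_not_commutative φ h3,
      C6.exists_semidirect_C3_fullyRealizable φ hA h⟩, ?_, ?_,
    C6.semidirectC2_not_commutative _ C6.YQAction_x_pow_three_ne_one,
    C6.exists_semidirect_C3_fullyRealizable _ (by decide) C6.not_isDirectSummand_YQAction⟩
  · rw [SemidirectProduct.card]
    simp
  · rw [SemidirectProduct.card, C6.card_zpowers_x_pow_three]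
    simp
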